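/- Let $A=\{a_1,\dots,a_n\}$ be a set of $n$ relatively prime positive integers that is the minimal generating set of the numerical semigroup $\mathcal S=\langle A\rangle=\{u_1a_1+\cdots+u_na_n \mid u_i\in\mathbb N\}$, i.e. no proper subset of $A$ generates $\mathcal S$. Assume that $\mathcal S$ is universally free, i.e. for every arrangement $(b_1,\dots,b_n)$ of $A$ one has $$\operatorname{lcm}\bigl(b_i,\gcd(b_{i+1},\dots,b_n)\bigr)\in\langle b_{i+1},\dots,b_n\rangle\qquad\text{for all } i\in\{1,\dots,n-1\}.$$ Let $\mathbb K$ be any field, let $\deg_A(\mathbf x^{\mathbf u})=u_1a_1+\cdots+u_na_n$ for $\mathbf u\in\mathbb N^n$, and let $I_A=\langle \mathbf x^{\mathbf u}-\mathbf x^{\mathbf v}\mid \deg_A(\mathbf x^{\mathbf u})=\deg_A(\mathbf x^{\mathbf v})\rangle\subseteq\mathbb K[x_1,\dots,x_n]$ be the toric ideal of $A$. A Markov basis of $I_A$ is a generating set of $I_A$ that consists of binomials $\mathbf x^{\mathbf u}-\mathbf x^{\mathbf v}$ and is minimal for inclusion; the Betti degrees of $I_A$ are the $A$-degrees of the elements of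 Markov bases of $I_A$, and $\operatorname{Betti}(A)$ denotes the set of all of them. A circuit of $I_A$ is a binomial $\mathbf x^{\mathbf u}-\mathbf x^{\mathbf v}\in I_A$ such that $\mathbf u$ and $\mathbf v$ have disjoint supports, the nonzero entries of $\mathbf u+\mathbf v$ are relatively prime (that is, their greatest common divisor is $1$), and no nonzero binomial $\mathbf x^{\mathbf u'}-\mathbf x^{\mathbf v'}\in I_A$ satisfies $\operatorname{supp}(\mathbf u')\cup\operatorname{supp}(\mathbf v')\subsetneq\operatorname{supp}(\mathbf u)\cup\operatorname{supp}(\mathbf v)$. For $n\ge 2$ put $$c_i=\min\{c\in\mathbb Z^+\mid c\,a_i\in\langle A\setminus\{a_i\}\rangle\},\qquad i\in\{1,\dots,n\}.$$ Then: (a) if $n\ge 2$, then $c_i=\gcd(A\setminus\{a_i\})$ for every $i\in\{1,\dots,n\}$; (b) each Betti degree of $I_A$ is divisible by $c_ka_k$ for some $k\in\{1,\dots,n\}$ (for $n=1$ there are no Betti degrees); (c) $I_A$ is minimally generated by $n-1$ circuits, i.e. it has a Markov basis consisting of exactly $n-1$ circuits; (d) $\operatorname{Betti}(A)=\{\operatorname{lcm}(a_i,a_j)\mid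 i\neq j\}$. -/

import Mathlib

namespace NumSemigroup

open MvPolynomial

/-- `A = {a_1, …, a_n}` (listed without repetition) is a set of relatively prime positive integers
and is the minimal generating set of the numerical semigroup `⟨A⟩`, that is, no proper subset
of `A` generates the same submonoid of `ℕ`. -/
structure IsMinimalGeneratingSet {n : ℕ} (a : Fin n → ℕ) : Prop where
  injective : Function.Injective a
  pos : ∀ i, 0 < a i
  gcd_eq_one : Finset.univ.gcd a = 1
  minimal : ∀ B : Set ℕ, B ⊂ Set.range a →
    AddSubmonoid.closure B ≠ AddSubmonoid.closure (Set.range a)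

/-- Freeness for the arrangement `(a_1, …, a_n)`:
`lcm(a_i, gcd(a_{i+1}, …, a_n)) ∈ ⟨a_{i+1}, …, a_n⟩` for every index `i` but the last one. -/
def IsFreeFor {n : ℕ} (a : Fin n → ℕ) : Prop :=
  ∀ i : Fin n, (i : ℕ) + 1 < n →
    Nat.lcm (a i) ((Finset.Ioi i).gcd a) ∈ AddSubmonoid.closure (a '' Set.Ioi i)

/-- Freeness for every arrangement of the generators. -/
def IsUniversallyFree {n : ℕ} (a : Fin n → ℕ) : Prop :=
  ∀ σ : Equiv.Perm (Fin n), IsFreeFor (a ∘ σ)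

/-- `c_i = min {c ∈ ℤ⁺ | c a_i ∈ ⟨a_j : j ≠ i⟩}`. The set is nonempty as soon as `n ≥ 2`
and the `a_j` are positive, see `isLeast_criticalExponent`. -/
noncomputable def criticalExponent {n : ℕ} (a : Fin n → ℕ) (i : Fin n) : ℕ :=
  sInf {c : ℕ | 0 < c ∧ c * a i ∈ AddSubmonoid.closure (a '' {j | j ≠ i})}

theorem isLeast_criticalExponent {n : ℕ} (hn : 2 ≤ n) (a : Fin n → ℕ) (ha : ∀ i, 0 < a i)
    (i : Fin n) :
    IsLeast {c : ℕ | 0 < c ∧ c * a i ∈ AddSubmonoid.closure (a '' {j | j ≠ i})}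
      (criticalExponent a i) := by
  have : Nontrivial (Fin n) := Fin.nontrivial_iff_two_le.2 hn
  obtain ⟨j, hj⟩ := exists_ne i
  refine ⟨Nat.sInf_mem ⟨a j, ha j, ?_⟩, fun c hc => Nat.sInf_le hc⟩
  have h : a j ∈ AddSubmonoid.closure (a '' {j | j ≠ i}) :=
    AddSubmonoid.subset_closure ⟨j, hj, rfl⟩
  rw [mul_comm]
  exact AddSubmonoid.nsmul_mem _ h (a i)

/-- The pure difference binomial `x^u - x^v`. -/
noncomputable def binom (K : Type*) [Field K] {n : ℕ} (u v : Fin n →₀ ℕ) :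
    MvPolynomial (Fin n) K :=
  monomial u 1 - monomial v 1

/-- The toric ideal `I_A`, generated by the `x^u - x^v` with `deg_A(x^u) = deg_A(x^v)`;
`Finsupp.weight a u` is the `A`-degree `∑ i, u_i a_i` of `x^u`. -/
noncomputable def toricIdeal (K : Type*) [Field K] {n : ℕ} (a : Fin n → ℕ) :
    Ideal (MvPolynomial (Fin n) K) :=
  Ideal.span {f | ∃ u v : Fin n →₀ ℕ, Finsupp.weight a u = Finsupp.weight a v ∧ f = binom K u v}

/-- A Markov basis of `I_A`: a generating set of binomials that is minimal for inclusion. -/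
def IsMarkovBasis (K : Type*) [Field K] {n : ℕ} (a : Fin n → ℕ)
    (M : Set (MvPolynomial (Fin n) K)) : Prop :=
  Minimal (fun N : Set (MvPolynomial (Fin n) K) =>
    (∀ f ∈ N, ∃ u v : Fin n →₀ ℕ, f = binom K u v) ∧ Ideal.span N = toricIdeal K a) M

/-- The Betti degrees of `I_A`: the `A`-degrees of the binomials in Markov bases of `I_A`. -/
def bettiDegrees (K : Type*) [Field K] {n : ℕ} (a : Fin n → ℕ) : Set ℕ :=
  {β | ∃ M, IsMarkovBasis K a M ∧ ∃ u v : Fin n →₀ ℕ, binom K u v ∈ M ∧ Finsupp.weight a u = β}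

/-- A circuit of `I_A`: a binomial `x^u - x^v ∈ I_A` that is irreducible (`u` and `v` have
disjoint supports and the nonzero entries of `u + v` are relatively prime) and such that no
(nonzero) binomial of `I_A` has strictly smaller support. -/
def IsCircuit (K : Type*) [Field K] {n : ℕ} (a : Fin n → ℕ) (f : MvPolynomial (Fin n) K) : Prop :=
  ∃ u v : Fin n →₀ ℕ, f = binom K u v ∧ binom K u v ∈ toricIdeal K a ∧
    Disjoint u.support v.support ∧ (u + v).support.gcd (u + v) = 1 ∧
    ∀ u' v' : Fin n →₀ ℕ, u' ≠ v' → binom K u' v' ∈ toricIdeal K a →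
      ¬ (u'.support ∪ v'.support ⊂ u.support ∪ v.support)

end NumSemigroup

/-!
# Toric ideals of universally free numerical semigroups

Freeness for every arrangement amounts to `lcm(a_k, gcd T) ∈ ⟨a_t : t ∈ T⟩` for every nonempty set
`T` of indices and every `k ∉ T`. The arithmetic core (`exists_dvd_lcm_gcd`) is that then
`lcm(a_k, gcd T) = lcm(a_k, a_j)` for some `j ∈ T`. To see this, put
`f(i) = lcm(a_i, gcd(S \ i))` for `i ∈ S = T ∪ {k}` and let `p` minimize `f`. Writing `f(p)` as a
combination of the other generators, each nonzero term `u_q a_q` is a multiple of `f(q)`, so by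
minimality there is a single term and `f(p) = f(q)` for some `q ≠ p`
(`exists_lcm_gcd_erase_eq`). If `k` is `p` or `q` this is the claim; otherwise `p` can be dropped
from `T` without changing `lcm(a_k, gcd T)`, and induction applies.

On the algebraic side, `x^u - x^v` lies in the ideal generated by a set of pure difference
binomials exactly when `u` and `v` are related by the congruence on `ℕ^n` that their exponents
generate (`binom_mem_span_iff`), so all ideal membership questions become questions on moves
between exponent vectors. Adding the indices one at a time in any order, the arithmetic core
provides for each new index `k` an earlier index `j` such that the circuit
`x_k^(l / a_k) - x_j^(l / a_j)`, `l = lcm(a_k, a_j)`, removes `x_k` from any pair of monomials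
of equal degree (`IsGluing.moves_of_weight_eq`). This gives `n - 1` circuits generating `I_A`. A
generating set has at least `n - 1` elements, since the differences of its exponent vectors span
the kernel of the degree map (`le_card_of_span_eq`), so the circuits form a Markov basis.

Starting with `i` and `j` shows that `lcm(a_i, a_j)` is a Betti degree. Conversely, a Betti degree
occurs among the degrees of any generating set (`exists_weight_eq_of_mem_bettiDegrees`), hence is
some `lcm(a_i, a_j)`; it is divisible by `c_i a_i`, where `c_i = gcd(A \ a_i)` divides `a_j` and
is coprime to `a_i`.
-/

namespace NumSemigroup

open MvPolynomial

/-! ### Arithmetic of universally free families -/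

/-- Freeness of a family in a form that refers to no arrangement:
`lcm(a_k, gcd(a_t : t ∈ T))` lies in the semigroup generated by the `a_t`, `t ∈ T`, for every
nonempty `T` and every `k ∉ T`. It passes to all subfamilies. -/
def IsSubsetFree {ι : Type*} [DecidableEq ι] (a : ι → ℕ) : Prop :=
  ∀ (T : Finset ι) (k : ι), T.Nonempty → k ∉ T →
    Nat.lcm (a k) (T.gcd a) ∈ AddSubmonoid.closure (a '' (T : Set ι))

/-- Any disjoint `k` and `T` occur in some arrangement as an entry and the set of the entries
after it. -/
theorem exists_perm_image_Ioi {n : ℕ} (T : Finset (Fin n)) (k : Fin n) (hk : k ∉ T) :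
    ∃ (σ : Equiv.Perm (Fin n)) (i : Fin n), (i : ℕ) + 1 + T.card = n ∧ σ i = k ∧
      (Finset.Ioi i).image σ = T := by
  have hT : T.card + 1 ≤ n := by
    have := Finset.card_le_univ (insert k T)
    rwa [Finset.card_insert_of_notMem hk, Fintype.card_fin] at this
  let i : Fin n := ⟨n - 1 - T.card, by omega⟩
  have hi : (i : ℕ) + 1 + T.card = n := by simp only [i]; omega
  have hcard : (Finset.Ioi i).card = T.card := by rw [Fin.card_Ioi]; omega
  let e : {x // x ∈ Finset.Ioi i} ≃ {x // x ∈ T} := Finset.equivOfCardEq hcard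
  let τ : Equiv.Perm (Fin n) := e.extendSubtype
  have hτ : ∀ x, τ x ∈ T ↔ x ∈ Finset.Ioi i := fun x =>
    ⟨fun h => by
      by_contra hx
      exact e.extendSubtype_not_mem x hx h, fun hx => e.extendSubtype_mem x hx⟩
  have hτi : τ i ∉ T := by rw [hτ]; simp
  refine ⟨τ.trans (Equiv.swap (τ i) k), i, hi, by simp, ?_⟩
  refine Finset.eq_of_subset_of_card_le ?_ ?_
  · intro y hy
    obtain ⟨x, hx, rfl⟩ := Finset.mem_image.1 hy
    have hxT := (hτ x).2 hx
    rw [Equiv.trans_apply, Equiv.swap_apply_of_ne_of_ne]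
    · exact hxT
    · rintro h; exact hτi (h ▸ hxT)
    · rintro h; exact hk (h ▸ hxT)
  · rw [Finset.card_image_of_injective _ (Equiv.injective _), hcard]

theorem IsUniversallyFree.isSubsetFree {n : ℕ} {a : Fin n → ℕ} (h : IsUniversallyFree a) :
    IsSubsetFree a := by
  intro T k hT hk
  obtain ⟨σ, i, hi, rfl, rfl⟩ := exists_perm_image_Ioi T k hk
  have hpos := hT.card_pos
  have := h σ i (by omega)
  rw [Finset.gcd_image]
  rw [Set.image_comp] at this
  simpa using this

theorem exists_sum_of_mem_closure_image {ι : Type*} [DecidableEq ι] {a : ι → ℕ} {T : Finset ι}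
    {x : ℕ} (hx : x ∈ AddSubmonoid.closure (a '' (T : Set ι))) :
    ∃ u : ι → ℕ, ∑ i ∈ T, u i * a i = x := by
  induction hx using AddSubmonoid.closure_induction with
  | mem x hx =>
    obtain ⟨i, hi, rfl⟩ := hx
    exact ⟨Pi.single i 1, by
      rw [Finset.sum_eq_single_of_mem i hi] <;> simp +contextual⟩
  | zero => exact ⟨0, by simp⟩
  | add x y _ _ hx hy =>
    obtain ⟨u, rfl⟩ := hx
    obtain ⟨v, rfl⟩ := hy
    exact ⟨u + v, by simp [add_mul, Finset.sum_add_distrib]⟩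

/-- In a family with at least two members, the least value of `i ↦ lcm(a_i, gcd(a_j : j ≠ i))` is
attained at least twice. -/
theorem exists_lcm_gcd_erase_eq {ι : Type*} [DecidableEq ι] {a : ι → ℕ} (ha : ∀ i, 0 < a i)
    (hfree : IsSubsetFree a) {S : Finset ι} (hS : S.Nontrivial) :
    ∃ p ∈ S, ∃ q ∈ S, p ≠ q ∧
      Nat.lcm (a p) ((S.erase p).gcd a) = Nat.lcm (a q) ((S.erase q).gcd a) := by
  obtain ⟨p, hp, hmin⟩ := S.exists_min_image (fun i => Nat.lcm (a i) ((S.erase i).gcd a))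
    hS.nonempty
  have hne : (S.erase p).Nonempty := hS.erase_nonempty
  obtain ⟨u, hu⟩ := exists_sum_of_mem_closure_image (hfree _ p hne (Finset.notMem_erase p S))
  have hgpos : 0 < (S.erase p).gcd a := by
    obtain ⟨j, hj⟩ := hne
    exact Nat.pos_of_dvd_of_pos (Finset.gcd_dvd hj) (ha j)
  have hpos : 0 < Nat.lcm (a p) ((S.erase p).gcd a) := Nat.lcm_pos (ha p) hgpos
  obtain ⟨q, hq, hq0⟩ : ∃ q ∈ S.erase p, u q * a q ≠ 0 := by
    by_contra! h
    rw [Finset.sum_eq_zero h] at hu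
    omega
  have hqp := Finset.ne_of_mem_erase hq
  refine ⟨p, hp, q, Finset.mem_of_mem_erase hq, hqp.symm,
    le_antisymm (hmin q (Finset.mem_of_mem_erase hq)) ?_⟩
  -- `gcd (S \ q)` divides every term of the representation other than the `q`-th one.
  have hdvd : (S.erase q).gcd a ∣ u q * a q := by
    rw [← Finset.add_sum_erase _ _ hq] at hu
    have hrest : (S.erase q).gcd a ∣ ∑ x ∈ (S.erase p).erase q, u x * a x := by
      refine Finset.dvd_sum fun j hj => ?_
      refine Dvd.dvd.mul_left (Finset.gcd_dvd ?_) _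
      simp only [Finset.mem_erase] at hj ⊢
      tauto
    rw [Nat.dvd_add_iff_left hrest, hu]
    exact (Finset.gcd_dvd (Finset.mem_erase.2 ⟨hqp.symm, hp⟩)).trans (Nat.dvd_lcm_left _ _)
  calc Nat.lcm (a q) ((S.erase q).gcd a)
      ≤ u q * a q := Nat.le_of_dvd (Nat.pos_of_ne_zero hq0)
        (Nat.lcm_dvd (Dvd.intro_left _ rfl) hdvd)
    _ ≤ ∑ i ∈ S.erase p, u i * a i :=
        Finset.single_le_sum (f := fun i => u i * a i) (fun _ _ => Nat.zero_le _) hq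
    _ = _ := hu

/-- An instance of distributivity of the divisibility lattice:
`lcm(k, gcd(p, g)) = gcd(lcm(k, p), lcm(k, g))`. -/
theorem dvd_lcm_gcd_of_dvd_lcm {k p g : ℕ} (hk : k ≠ 0) (hp : p ≠ 0) (h : g ∣ Nat.lcm k p) :
    g ∣ Nat.lcm k (Nat.gcd p g) := by
  have hl : Nat.lcm k p ≠ 0 := Nat.lcm_ne_zero hk hp
  have hg : g ≠ 0 := ne_zero_of_dvd_ne_zero hl h
  have hpg : Nat.gcd p g ≠ 0 := Nat.gcd_ne_zero_left hp
  rw [← Nat.factorization_le_iff_dvd hg hl, Nat.factorization_lcm hk hp] at h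
  rw [← Nat.factorization_le_iff_dvd hg (Nat.lcm_ne_zero hk hpg), Nat.factorization_lcm hk hpg,
    Nat.factorization_gcd hp hg]
  intro r
  have hr := h r
  simp only [Finsupp.sup_apply, Finsupp.inf_apply] at hr ⊢
  omega

/-- Equivalently `lcm(a_k, gcd T) = lcm(a_k, a_j)`, see `lcm_gcd_eq_lcm_of_dvd`. -/
theorem exists_dvd_lcm_gcd {ι : Type*} [DecidableEq ι] {a : ι → ℕ} (ha : ∀ i, 0 < a i)
    (hfree : IsSubsetFree a) (T : Finset ι) (k : ι) (hT : T.Nonempty) (hk : k ∉ T) :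
    ∃ j ∈ T, a j ∣ Nat.lcm (a k) (T.gcd a) := by
  induction T using Finset.strongInduction with
  | H T ih =>
  have hS : (insert k T).Nontrivial := by
    obtain ⟨t, ht⟩ := hT
    exact ⟨k, by simp, t, by simp [ht], fun h => hk (h ▸ ht)⟩
  obtain ⟨p, hp, q, hq, hpq, heq⟩ := exists_lcm_gcd_erase_eq ha hfree hS
  have hke : (insert k T).erase k = T := Finset.erase_insert hk
  by_cases hpk : p = k
  · subst hpk
    rw [hke] at heq
    exact ⟨q, Finset.mem_of_mem_insert_of_ne hq hpq.symm, heq ▸ Nat.dvd_lcm_left _ _⟩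
  by_cases hqk : q = k
  · subst hqk
    rw [hke] at heq
    exact ⟨p, Finset.mem_of_mem_insert_of_ne hp hpq, heq ▸ Nat.dvd_lcm_left _ _⟩
  have hpT := Finset.mem_of_mem_insert_of_ne hp hpk
  have hqT : q ∈ T.erase p :=
    Finset.mem_erase.2 ⟨hpq.symm, Finset.mem_of_mem_insert_of_ne hq hqk⟩
  obtain ⟨j, hj, hjd⟩ := ih (T.erase p) (Finset.erase_ssubset hpT) ⟨q, hqT⟩
    fun h => hk (Finset.mem_of_mem_erase h)
  refine ⟨j, Finset.mem_of_mem_erase hj, hjd.trans (Nat.lcm_dvd (Nat.dvd_lcm_left _ _) ?_)⟩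
  -- `a q ∣ lcm (a p) (gcd (S \ p))` and `k ∈ S \ p`, so `p` does not contribute to
  -- `lcm (a k) (gcd T)`.
  have hG : (T.erase p).gcd a ∣ Nat.lcm (a k) (a p) := by
    refine (Finset.gcd_dvd hqT).trans ((Nat.dvd_lcm_left _ (((insert k T).erase q).gcd a)).trans ?_)
    rw [← heq, Nat.lcm_comm (a k)]
    exact _root_.lcm_dvd_lcm (dvd_refl _)
      (Finset.gcd_dvd (Finset.mem_erase.2 ⟨fun h => hpk h.symm, Finset.mem_insert_self _ _⟩))
  have hTg : T.gcd a = Nat.gcd (a p) ((T.erase p).gcd a) := by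
    conv_lhs => rw [← Finset.insert_erase hpT]
    rw [Finset.gcd_insert]; rfl
  rw [hTg]
  exact dvd_lcm_gcd_of_dvd_lcm (ha k).ne' (ha p).ne' hG

theorem lcm_gcd_eq_lcm_of_dvd {ι : Type*} {a : ι → ℕ} {T : Finset ι} {k j : ι} (hj : j ∈ T)
    (h : a j ∣ Nat.lcm (a k) (T.gcd a)) : Nat.lcm (a k) (T.gcd a) = Nat.lcm (a k) (a j) :=
  Nat.dvd_antisymm (_root_.lcm_dvd_lcm (dvd_refl _) (Finset.gcd_dvd hj))
    (Nat.lcm_dvd (Nat.dvd_lcm_left _ _) h)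

theorem criticalExponent_eq_gcd {n : ℕ} {a : Fin n → ℕ} (hn : 2 ≤ n) (ha : ∀ i, 0 < a i)
    (hgcd : Finset.univ.gcd a = 1) (hfree : IsSubsetFree a) (i : Fin n) :
    criticalExponent a i = (Finset.univ.erase i).gcd a := by
  have : Nontrivial (Fin n) := Fin.nontrivial_iff_two_le.2 hn
  obtain ⟨j, hj⟩ := exists_ne i
  have hjm : j ∈ Finset.univ.erase i := by simp [hj]
  have hset : ((Finset.univ.erase i : Finset (Fin n)) : Set (Fin n)) = {j | j ≠ i} := by
    ext; simp
  have hcop : Nat.Coprime ((Finset.univ.erase i).gcd a) (a i) := by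
    rw [Nat.coprime_comm, Nat.Coprime, ← hgcd]
    conv_rhs => rw [← Finset.insert_erase (Finset.mem_univ i)]
    rw [Finset.gcd_insert]; rfl
  have hleast := isLeast_criticalExponent hn a ha i
  refine le_antisymm (hleast.2 ⟨Nat.pos_of_dvd_of_pos (Finset.gcd_dvd hjm) (ha j), ?_⟩) ?_
  · have := hfree (Finset.univ.erase i) i ⟨j, hjm⟩ (Finset.notMem_erase _ _)
    rwa [hset, Nat.lcm_comm, hcop.lcm_eq_mul] at this
  · obtain ⟨hpos, hmem⟩ := hleast.1
    refine Nat.le_of_dvd hpos (hcop.dvd_of_dvd_mul_right ?_)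
    rw [← hset] at hmem
    obtain ⟨u, hu⟩ := exists_sum_of_mem_closure_image hmem
    rw [← hu]
    exact Finset.dvd_sum fun l hl => (Finset.gcd_dvd hl).mul_left _

theorem gcd_erase_mul_dvd_lcm {n : ℕ} {a : Fin n → ℕ} (hgcd : Finset.univ.gcd a = 1)
    {i j : Fin n} (hij : i ≠ j) :
    (Finset.univ.erase i).gcd a * a i ∣ Nat.lcm (a i) (a j) := by
  have hcop : Nat.Coprime ((Finset.univ.erase i).gcd a) (a i) := by
    rw [Nat.coprime_comm, Nat.Coprime, ← hgcd]
    conv_rhs => rw [← Finset.insert_erase (Finset.mem_univ i)]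
    rw [Finset.gcd_insert]; rfl
  refine hcop.mul_dvd_of_dvd_of_dvd ?_ (Nat.dvd_lcm_left _ _)
  exact (Finset.gcd_dvd (by simp [hij.symm])).trans (Nat.dvd_lcm_right _ _)

/-! ### Binomial ideals and congruences of exponent vectors -/

variable {K : Type*} [Field K] {n : ℕ}

/-- Pairs `(u, v)` of exponent vectors, standing for the binomials `x^u - x^v`. -/
abbrev ExpPair (n : ℕ) : Type := (Fin n →₀ ℕ) × (Fin n →₀ ℕ)

/-- The congruence on exponent vectors generated by a set of pairs: `u` and `v` are related when
`x^u` can be rewritten to `x^v` using the binomials `x^p - x^q`, `(p, q) ∈ R`. -/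
noncomputable def moves (R : Set (ExpPair n)) : AddCon (Fin n →₀ ℕ) :=
  addConGen fun u v => (u, v) ∈ R

theorem moves_le {R : Set (ExpPair n)} {c : AddCon (Fin n →₀ ℕ)} :
    moves R ≤ c ↔ ∀ u v, (u, v) ∈ R → c u v :=
  AddCon.addConGen_le

theorem moves_of_mem {R : Set (ExpPair n)} {u v : Fin n →₀ ℕ}
    (h : (u, v) ∈ R) : moves R u v :=
  moves_le.1 le_rfl u v h

/-- The exponent pairs of the pure difference binomials in an ideal form a congruence. -/
def idealCon (J : Ideal (MvPolynomial (Fin n) K)) : AddCon (Fin n →₀ ℕ) where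
  r u v := binom K u v ∈ J
  iseqv :=
    { refl := fun u => by simp [binom]
      symm := fun {u v} h => by simpa [binom] using J.neg_mem h
      trans := fun {u v w} h h' => by simpa [binom] using J.add_mem h h' }
  add' := by
    intro u v u' v' h h'
    have := J.add_mem (J.mul_mem_left (monomial u' 1) h) (J.mul_mem_left (monomial v 1) h')
    simp only [binom, mul_sub, monomial_mul, mul_one] at this
    rwa [add_comm u' u, add_comm u' v, sub_add_sub_cancel] at this

theorem idealCon_apply {J : Ideal (MvPolynomial (Fin n) K)} {u v : Fin n →₀ ℕ} :
    idealCon J u v ↔ binom K u v ∈ J := Iff.rfl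

/-- Binomials in an ideal generated by binomials of a congruence `c` belong to `c`: the ideal is
killed by the map from polynomials to the monoid algebra of the quotient by `c`. -/
theorem rel_of_binom_mem_span {c : AddCon (Fin n →₀ ℕ)} {N : Set (MvPolynomial (Fin n) K)}
    (hN : ∀ f ∈ N, ∃ u v, c u v ∧ f = binom K u v) {u v : Fin n →₀ ℕ}
    (h : binom K u v ∈ Ideal.span N) : c u v := by
  let φ : MvPolynomial (Fin n) K →+* AddMonoidAlgebra K c.Quotient :=
    AddMonoidAlgebra.mapDomainRingHom K c.mk'
  have hφ : ∀ u v, φ (binom K u v) =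
      AddMonoidAlgebra.single (c.mk' u) 1 - AddMonoidAlgebra.single (c.mk' v) 1 := by
    intro u v
    rw [binom, map_sub]
    congr 1 <;> exact AddMonoidAlgebra.mapDomain_single
  have hker : Ideal.span N ≤ RingHom.ker φ := by
    refine Ideal.span_le.2 fun f hf => ?_
    obtain ⟨u, v, huv, rfl⟩ := hN f hf
    rw [SetLike.mem_coe, RingHom.mem_ker, hφ]
    rw [show c.mk' u = c.mk' v from c.eq.2 huv, sub_self]
  have := hker h
  rw [RingHom.mem_ker, hφ, sub_eq_zero] at this
  exact c.eq.1 (AddMonoidAlgebra.single_left_injective one_ne_zero this)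

theorem binom_mem_span_iff {R : Set (ExpPair n)} {u v : Fin n →₀ ℕ} :
    binom K u v ∈ Ideal.span ((fun r => binom K r.1 r.2) '' R) ↔ moves R u v := by
  refine ⟨rel_of_binom_mem_span ?_, fun h => idealCon_apply.1 (moves_le.2 ?_ h)⟩
  · rintro _ ⟨⟨p, q⟩, hr, rfl⟩
    exact ⟨p, q, moves_of_mem hr, rfl⟩
  · exact fun p q hr => Ideal.subset_span ⟨(p, q), hr, rfl⟩

theorem binom_mem_toricIdeal_iff {a : Fin n → ℕ} {u v : Fin n →₀ ℕ} :
    binom K u v ∈ toricIdeal K a ↔ Finsupp.weight a u = Finsupp.weight a v := by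
  refine ⟨fun h => ?_, fun h => Ideal.subset_span ⟨u, v, h, rfl⟩⟩
  refine rel_of_binom_mem_span (c := AddCon.ker (Finsupp.weight a)) ?_ h
  rintro f ⟨u, v, huv, rfl⟩
  exact ⟨u, v, huv, rfl⟩

/-- The degree of a nonzero homogeneous binomial does not depend on the exponents chosen to
represent it (in characteristic two they are determined only up to order). -/
theorem weight_eq_of_binom_eq {a : Fin n → ℕ} {u v p q : Fin n →₀ ℕ} (hne : u ≠ v)
    (hpq : Finsupp.weight a p = Finsupp.weight a q) (h : binom K u v = binom K p q) :
    Finsupp.weight a u = Finsupp.weight a p := by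
  by_contra hw
  have hp : p ≠ u := by rintro rfl; exact hw rfl
  have hq : q ≠ u := by rintro rfl; exact hw hpq.symm
  have := congrArg (coeff u) h
  simp [binom, coeff_monomial, hne.symm, hp, hq] at this

/-- A set of pairs of equal weight generates the toric ideal exactly when any two exponent vectors
of the same weight are joined by moves. -/
theorem span_eq_toricIdeal_iff {a : Fin n → ℕ} {R : Set (ExpPair n)} :
    Ideal.span ((fun r => binom K r.1 r.2) '' R) = toricIdeal K a ↔
      ∀ u v, moves R u v ↔ Finsupp.weight a u = Finsupp.weight a v := by
  constructor
  · intro h u v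
    rw [← binom_mem_span_iff (K := K), h, binom_mem_toricIdeal_iff]
  · intro h
    refine le_antisymm (Ideal.span_le.2 ?_) (Ideal.span_le.2 ?_)
    · rintro _ ⟨⟨p, q⟩, hr, rfl⟩
      exact binom_mem_toricIdeal_iff.2 ((h p q).1 (moves_of_mem hr))
    · rintro _ ⟨u, v, huv, rfl⟩
      exact binom_mem_span_iff.2 ((h u v).2 huv)

/-- A move applied to a vector has weight at most that of the vector, so only the pairs of
at most that weight are needed. -/
theorem moves_weight_le {a : Fin n → ℕ} {R : Set (ExpPair n)}
    (hR : ∀ r ∈ R, Finsupp.weight a r.1 = Finsupp.weight a r.2) {u v : Fin n →₀ ℕ}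
    (h : moves R u v) :
    moves {r ∈ R | Finsupp.weight a r.1 ≤ Finsupp.weight a u} u v := by
  let B (m : ℕ) : AddCon (Fin n →₀ ℕ) := moves {r ∈ R | Finsupp.weight a r.1 ≤ m}
  have hB : ∀ {m m'}, m ≤ m' → B m ≤ B m' := fun hm =>
    moves_le.2 fun p q hr => moves_of_mem ⟨hr.1, hr.2.trans hm⟩
  -- Being joined by such moves is itself a congruence, as adding vectors only raises weights.
  let c : AddCon (Fin n →₀ ℕ) :=
    { r := fun u v => Finsupp.weight a u = Finsupp.weight a v ∧ B (Finsupp.weight a u) u v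
      iseqv :=
        { refl := fun u => ⟨rfl, (B _).refl u⟩
          symm := fun {u v} h => ⟨h.1.symm, h.1 ▸ (B _).symm h.2⟩
          trans := fun {u v w} h h' =>
            ⟨h.1.trans h'.1, (B _).trans h.2 (h.1 ▸ h'.2)⟩ }
      add' := by
        rintro u v u' v' ⟨h1, h2⟩ ⟨h1', h2'⟩
        refine ⟨by rw [map_add, map_add, h1, h1'], (B _).add (hB ?_ h2) (hB ?_ h2')⟩ <;>
          simp }
  have hle : moves R ≤ c := moves_le.2 fun p q hr => ⟨hR _ hr, moves_of_mem ⟨hr, le_rfl⟩⟩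
  exact (hle h).2

/-! ### Circuits and gluings -/

/-- The exponent pair of the circuit `x_k^{l / a_k} - x_j^{l / a_j}`, `l = lcm(a_k, a_j)`. -/
noncomputable def circuitPair (a : Fin n → ℕ) (k j : Fin n) : ExpPair n :=
  (Finsupp.single k (Nat.lcm (a k) (a j) / a k), Finsupp.single j (Nat.lcm (a k) (a j) / a j))

theorem weight_circuitPair_fst (a : Fin n → ℕ) (k j : Fin n) :
    Finsupp.weight a (circuitPair a k j).1 = Nat.lcm (a k) (a j) := by
  simp [circuitPair, Finsupp.weight_single, Nat.div_mul_cancel (Nat.dvd_lcm_left _ _)]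

theorem weight_circuitPair_snd (a : Fin n → ℕ) (k j : Fin n) :
    Finsupp.weight a (circuitPair a k j).2 = Nat.lcm (a k) (a j) := by
  simp [circuitPair, Finsupp.weight_single, Nat.div_mul_cancel (Nat.dvd_lcm_right _ _)]

theorem coprime_lcm_div_lcm_div {p q : ℕ} (hp : 0 < p) (hq : 0 < q) :
    Nat.Coprime (Nat.lcm p q / p) (Nat.lcm p q / q) := by
  have h1 : Nat.lcm p q / p = q / Nat.gcd p q := by
    refine Nat.div_eq_of_eq_mul_right hp ?_
    rw [Nat.lcm, Nat.mul_div_assoc _ (Nat.gcd_dvd_right p q)]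
  have h2 : Nat.lcm p q / q = p / Nat.gcd p q := by
    refine Nat.div_eq_of_eq_mul_left hq ?_
    rw [Nat.lcm, Nat.mul_div_right_comm (Nat.gcd_dvd_left p q)]
  rw [h1, h2, Nat.coprime_comm]
  exact Nat.coprime_div_gcd_div_gcd (Nat.gcd_pos_of_pos_left q hp)

theorem isCircuit_circuitPair {a : Fin n → ℕ} (ha : ∀ i, 0 < a i) {k j : Fin n} (hkj : k ≠ j) :
    IsCircuit K a (binom K (circuitPair a k j).1 (circuitPair a k j).2) := by
  have hl : 0 < Nat.lcm (a k) (a j) := Nat.lcm_pos (ha k) (ha j)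
  have hk : Nat.lcm (a k) (a j) / a k ≠ 0 :=
    (Nat.div_pos (Nat.le_of_dvd hl (Nat.dvd_lcm_left _ _)) (ha k)).ne'
  have hj : Nat.lcm (a k) (a j) / a j ≠ 0 :=
    (Nat.div_pos (Nat.le_of_dvd hl (Nat.dvd_lcm_right _ _)) (ha j)).ne'
  have hsk : (circuitPair a k j).1.support = {k} := by
    simp [circuitPair, Finsupp.support_single, hk]
  have hsj : (circuitPair a k j).2.support = {j} := by
    simp [circuitPair, Finsupp.support_single, hj]
  have hdisj : Disjoint (circuitPair a k j).1.support (circuitPair a k j).2.support := by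
    rw [hsk, hsj]; simpa using hkj
  refine ⟨_, _, rfl, ?_, hdisj, ?_, ?_⟩
  · rw [binom_mem_toricIdeal_iff, weight_circuitPair_fst, weight_circuitPair_snd]
  · rw [Finsupp.support_add_eq hdisj, hsk, hsj]
    have hcop := coprime_lcm_div_lcm_div (ha k) (ha j)
    simp only [circuitPair, Finset.gcd_union, Finset.gcd_singleton, Finsupp.coe_add, Pi.add_apply,
      Finsupp.single_eq_same, Finsupp.single_eq_of_ne hkj, Finsupp.single_eq_of_ne hkj.symm,
      add_zero, zero_add, normalize_eq]
    exact hcop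
  · intro u v huv hmem hss
    rw [binom_mem_toricIdeal_iff] at hmem
    rw [hsk, hsj] at hss
    have hcard : (u.support ∪ v.support).card ≤ 1 := by
      have := Finset.card_lt_card hss
      have h2 : ({k} ∪ {j} : Finset (Fin n)).card ≤ 2 := Finset.card_le_two
      omega
    have : ∃ m, u.support ∪ v.support ⊆ {m} := by
      have : Nonempty (Fin n) := ⟨k⟩
      exact Finset.card_le_one_iff_subset_singleton.1 hcard
    obtain ⟨m, hm⟩ := this
    obtain ⟨x, rfl⟩ := Finsupp.support_subset_singleton'.1 (Finset.union_subset_left hm)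
    obtain ⟨y, rfl⟩ := Finsupp.support_subset_singleton'.1 (Finset.union_subset_right hm)
    simp only [Finsupp.weight_single, smul_eq_mul] at hmem
    exact huv (by rw [Nat.eq_of_mul_eq_mul_right (ha m) hmem])

/-- Sets of exponent pairs obtained by adding the indices in `S` one at a time, each new index `k`
being joined by a circuit to an index `j` already present with
`lcm(a_k, a_j) = lcm(a_k, gcd(a_i : i present))`. -/
inductive IsGluing (a : Fin n → ℕ) :
    Finset (Fin n) → Finset (ExpPair n) → Prop
  | singleton (i : Fin n) : IsGluing a {i} ∅
  | adjoin {S : Finset (Fin n)} {R : Finset (ExpPair n)} {k j : Fin n}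
      (hS : IsGluing a S R) (hk : k ∉ S) (hj : j ∈ S)
      (hdvd : a j ∣ Nat.lcm (a k) (S.gcd a)) :
      IsGluing a (insert k S) (insert (circuitPair a k j) R)

namespace IsGluing

variable {a : Fin n → ℕ} {S : Finset (Fin n)} {R : Finset (ExpPair n)}

theorem exists_of_mem (h : IsGluing a S R) :
    ∀ r ∈ R, ∃ k j, k ≠ j ∧ r = circuitPair a k j := by
  induction h with
  | singleton i => simp
  | @adjoin S R k j hS hk hj hdvd ih =>
    intro r hr
    rcases Finset.mem_insert.1 hr with rfl | hr
    · exact ⟨_, _, by rintro rfl; exact hk hj, rfl⟩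
    · exact ih r hr

theorem weight_eq (h : IsGluing a S R) :
    ∀ r ∈ R, Finsupp.weight a r.1 = Finsupp.weight a r.2 := by
  intro r hr
  obtain ⟨k, j, -, rfl⟩ := h.exists_of_mem r hr
  rw [weight_circuitPair_fst, weight_circuitPair_snd]

theorem card_le (h : IsGluing a S R) : R.card + 1 ≤ S.card := by
  induction h with
  | singleton i => simp
  | @adjoin S R k j hS hk hj hdvd ih =>
    rw [Finset.card_insert_of_notMem hk]
    have := Finset.card_insert_le (circuitPair a k j) R
    omega

theorem nonempty (h : IsGluing a S R) : S.Nonempty := by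
  cases h <;> simp

/-- The indices of `T` can be added to a gluing in any order, so every gluing extends to all of
`T ∪ S₀`. -/
theorem extend (ha : ∀ i, 0 < a i) (hfree : IsSubsetFree a) {S₀ : Finset (Fin n)}
    {R₀ : Finset (ExpPair n)} (h : IsGluing a S₀ R₀) (T : Finset (Fin n)) :
    ∃ R, R₀ ⊆ R ∧ IsGluing a (T ∪ S₀) R := by
  induction T using Finset.induction_on with
  | empty => exact ⟨R₀, subset_rfl, by simpa using h⟩
  | insert k T hk ih =>
    obtain ⟨R, hR, hg⟩ := ih
    rw [Finset.insert_union]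
    by_cases hkS : k ∈ T ∪ S₀
    · exact ⟨R, hR, by rwa [Finset.insert_eq_of_mem hkS]⟩
    obtain ⟨j, hj, hdvd⟩ := exists_dvd_lcm_gcd ha hfree _ k hg.nonempty hkS
    exact ⟨_, hR.trans (Finset.subset_insert _ _), hg.adjoin hkS hj hdvd⟩

end IsGluing

theorem moves_mono {R R' : Set (ExpPair n)} (h : R ⊆ R') :
    moves R ≤ moves R' :=
  moves_le.2 fun _ _ hr => moves_of_mem (h hr)

theorem gcd_dvd_weight {a : Fin n → ℕ} {S : Finset (Fin n)} {u : Fin n →₀ ℕ}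
    (hu : u.support ⊆ S) : S.gcd a ∣ Finsupp.weight a u := by
  rw [Finsupp.weight_apply]
  exact Finset.dvd_sum fun i hi => (Finset.gcd_dvd (hu hi)).mul_left _

/-- Equal-weight vectors supported on `S` are joined by the moves of a gluing: the difference of
their exponents at the index added last is a multiple of the exponent of that index in its
circuit, so moves along this circuit make the two exponents agree. -/
theorem IsGluing.moves_of_weight_eq {a : Fin n → ℕ} (ha : ∀ i, 0 < a i) {S : Finset (Fin n)}
    {R : Finset (ExpPair n)} (h : IsGluing a S R) {u v : Fin n →₀ ℕ}
    (hu : u.support ⊆ S) (hv : v.support ⊆ S)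
    (huv : Finsupp.weight a u = Finsupp.weight a v) : moves (R : Set (ExpPair n)) u v := by
  induction h generalizing u v with
  | singleton i =>
    obtain ⟨x, rfl⟩ := Finsupp.support_subset_singleton'.1 hu
    obtain ⟨y, rfl⟩ := Finsupp.support_subset_singleton'.1 hv
    simp only [Finsupp.weight_single, smul_eq_mul] at huv
    rw [Nat.eq_of_mul_eq_mul_right (ha i) huv]
    exact (moves _).refl _
  | @adjoin S R k j hS hk hj hdvd ih =>
    -- Split off the common part `v k` of the exponents at `k`; `m` is what remains of `u k`.
    wlog hle : v k ≤ u k generalizing u v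
    · exact (moves _).symm (this hv hu huv.symm (le_of_not_ge hle))
    have hue : (u.erase k).support ⊆ S := by
      rw [Finsupp.support_erase]; exact Finset.subset_insert_iff.1 hu
    have hve : (v.erase k).support ⊆ S := by
      rw [Finsupp.support_erase]; exact Finset.subset_insert_iff.1 hv
    obtain ⟨m, hm⟩ := Nat.exists_eq_add_of_le hle
    have hu' : u = Finsupp.single k (v k) + (Finsupp.single k m + u.erase k) := by
      rw [← add_assoc, ← Finsupp.single_add, ← hm, Finsupp.single_add_erase]
    have hv' : v = Finsupp.single k (v k) + v.erase k := by
      rw [Finsupp.single_add_erase]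
    have hw : m * a k + Finsupp.weight a (u.erase k) = Finsupp.weight a (v.erase k) := by
      rw [hu', hv', map_add, map_add, map_add] at huv
      simpa [Finsupp.weight_single] using huv
    have hg : S.gcd a ∣ m * a k :=
      (Nat.dvd_add_iff_left (gcd_dvd_weight hue)).2 (hw ▸ gcd_dvd_weight hve)
    have hL : Nat.lcm (a k) (a j) ∣ m * a k := by
      rw [← lcm_gcd_eq_lcm_of_dvd hj hdvd]
      exact Nat.lcm_dvd (Dvd.intro_left _ rfl) hg
    obtain ⟨t, ht⟩ := hL
    have hdk := Nat.div_mul_cancel (Nat.dvd_lcm_left (a k) (a j))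
    have hmt : m = t * (Nat.lcm (a k) (a j) / a k) := by
      refine Nat.eq_of_mul_eq_mul_right (ha k) ?_
      rw [ht, mul_assoc, hdk, mul_comm]
    have hsm : Finsupp.single k m = t • (circuitPair a k j).1 := by
      rw [circuitPair, Finsupp.smul_single, smul_eq_mul, ← hmt]
    have hmove : moves (↑(insert (circuitPair a k j) R) : Set (ExpPair n))
        (t • (circuitPair a k j).1) (t • (circuitPair a k j).2) :=
      (moves _).nsmul t (moves_of_mem (by simp))
    have hih : moves (R : Set (ExpPair n)) (t • (circuitPair a k j).2 + u.erase k) (v.erase k) := by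
      refine ih ?_ hve ?_
      · refine Finsupp.support_add.trans (Finset.union_subset ?_ hue)
        refine Finsupp.support_smul.trans (Finsupp.support_single_subset.trans ?_)
        simpa using hj
      · rw [map_add, map_nsmul, weight_circuitPair_snd, ← hw, ht, smul_eq_mul, mul_comm]
    have hadd := (moves _).add ((moves _).refl (Finsupp.single k (v k))) ((moves _).trans
      ((moves _).add hmove ((moves _).refl (u.erase k))) (moves_mono (by simp) hih))
    rwa [← hsm, ← hu', ← hv'] at hadd

/-! ### Generating sets and Markov bases -/

theorem IsGluing.span_eq {a : Fin n → ℕ} (ha : ∀ i, 0 < a i)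
    {R : Finset (ExpPair n)} (h : IsGluing a Finset.univ R) :
    Ideal.span ((fun r => binom K r.1 r.2) '' (R : Set (ExpPair n))) = toricIdeal K a := by
  refine span_eq_toricIdeal_iff.2 fun u v => ⟨fun huv => ?_,
    h.moves_of_weight_eq ha (Finset.subset_univ _) (Finset.subset_univ _)⟩
  have hle : moves (R : Set (ExpPair n)) ≤ AddCon.ker (Finsupp.weight a) :=
    moves_le.2 fun p q hr => h.weight_eq _ hr
  exact hle huv

/-- Generating sets of the toric ideal have at least `n - 1` elements: the differences of their
exponent vectors together with one basis vector span `ℚ^n`. -/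
theorem le_card_of_span_eq {a : Fin n → ℕ} (ha : ∀ i, 0 < a i)
    {R : Finset (ExpPair n)}
    (h : Ideal.span ((fun r => binom K r.1 r.2) '' (R : Set (ExpPair n))) = toricIdeal K a) :
    n - 1 ≤ R.card := by
  classical
  rcases Nat.eq_zero_or_pos n with rfl | hn
  · simp
  let i₀ : Fin n := ⟨0, hn⟩
  let ψ : (Fin n →₀ ℕ) →+ (Fin n →₀ ℚ) := Finsupp.mapRange.addMonoidHom (Nat.castAddMonoidHom ℚ)
  let D : Finset (Fin n →₀ ℚ) := R.image fun r => ψ r.1 - ψ r.2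
  let V : Submodule ℚ (Fin n →₀ ℚ) := Submodule.span ℚ D
  have hV : ∀ u v, Finsupp.weight a u = Finsupp.weight a v → ψ u - ψ v ∈ V := by
    intro u v huv
    have hle : moves (R : Set (ExpPair n)) ≤ AddCon.ker ((V.mkQ.toAddMonoidHom).comp ψ) := by
      refine moves_le.2 fun p q hr => ?_
      exact (Submodule.Quotient.eq V).2
        (Submodule.subset_span (Finset.mem_coe.2 (Finset.mem_image.2 ⟨(p, q), hr, rfl⟩)))
    exact (Submodule.Quotient.eq V).1 (hle ((span_eq_toricIdeal_iff.1 h u v).2 huv))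
  let E : Finset (Fin n →₀ ℚ) := insert (Finsupp.single i₀ 1) D
  have hVE : V ≤ Submodule.span ℚ E := Submodule.span_mono (by simp [E])
  have htop : Submodule.span ℚ (E : Set (Fin n →₀ ℚ)) = ⊤ := by
    rw [eq_top_iff, ← (Finsupp.basisSingleOne (R := ℚ) (ι := Fin n)).span_eq, Submodule.span_le]
    rintro _ ⟨i, rfl⟩
    -- `a i₀ • e i - a i • e i₀` has weight zero.
    have h1 := hVE (hV (Finsupp.single i (a i₀)) (Finsupp.single i₀ (a i))
      (by simp [Finsupp.weight_single, mul_comm]))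
    have h0 : (Finsupp.single i₀ 1 : Fin n →₀ ℚ) ∈ Submodule.span ℚ (E : Set (Fin n →₀ ℚ)) :=
      Submodule.subset_span (by simp [E])
    have h2 := Submodule.smul_mem _ ((a i₀ : ℚ)⁻¹)
      (Submodule.add_mem _ h1 (Submodule.smul_mem _ (a i : ℚ) h0))
    have hne : (a i₀ : ℚ) ≠ 0 := by exact_mod_cast (ha i₀).ne'
    simpa [ψ, hne] using h2
  have hfr := finrank_span_finset_le_card (R := ℚ) E
  rw [Set.finrank, htop, finrank_top, Module.finrank_finsupp_self, Fintype.card_fin] at hfr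
  have h1 : E.card ≤ D.card + 1 := Finset.card_insert_le _ _
  have h2 : D.card ≤ R.card := Finset.card_image_le
  omega

theorem le_card_of_binomials {a : Fin n → ℕ} (ha : ∀ i, 0 < a i)
    {N : Finset (MvPolynomial (Fin n) K)} (hN : ∀ f ∈ N, ∃ u v : Fin n →₀ ℕ, f = binom K u v)
    (h : Ideal.span (N : Set (MvPolynomial (Fin n) K)) = toricIdeal K a) : n - 1 ≤ N.card := by
  classical
  choose! u v huv using hN
  refine (le_card_of_span_eq (K := K) (R := N.image fun f => (u f, v f)) ha ?_).trans
    Finset.card_image_le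
  rw [← h]
  congr 1
  ext f
  simp only [Finset.coe_image, Set.image_image, Set.mem_image, Finset.mem_coe]
  constructor
  · rintro ⟨g, hg, rfl⟩
    rwa [← huv g hg]
  · exact fun hf => ⟨f, hf, (huv f hf).symm⟩

/-- By the lower bound on the number of generators, the `n - 1` circuits of a gluing form a
Markov basis. -/
theorem IsGluing.exists_isMarkovBasis {a : Fin n → ℕ} (ha : ∀ i, 0 < a i)
    {R : Finset (ExpPair n)} (h : IsGluing a Finset.univ R) :
    ∃ C : Finset (MvPolynomial (Fin n) K),
      (C : Set (MvPolynomial (Fin n) K)) = (fun r => binom K r.1 r.2) '' (R : Set (ExpPair n)) ∧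
      C.card = n - 1 ∧ IsMarkovBasis K a (C : Set (MvPolynomial (Fin n) K)) := by
  classical
  let C : Finset (MvPolynomial (Fin n) K) := R.image fun r => binom K r.1 r.2
  have hC : (C : Set (MvPolynomial (Fin n) K)) =
      (fun r => binom K r.1 r.2) '' (R : Set (ExpPair n)) := by
    simp [C]
  have hspan : Ideal.span (C : Set (MvPolynomial (Fin n) K)) = toricIdeal K a := by
    rw [hC, h.span_eq ha]
  have hbin : ∀ f ∈ C, ∃ u v : Fin n →₀ ℕ, f = binom K u v := by
    intro f hf
    obtain ⟨r, -, rfl⟩ := Finset.mem_image.1 hf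
    exact ⟨_, _, rfl⟩
  have hle : C.card ≤ n - 1 := by
    have h1 : C.card ≤ R.card := Finset.card_image_le
    have h2 := h.card_le
    rw [Finset.card_univ, Fintype.card_fin] at h2
    omega
  refine ⟨C, hC, le_antisymm hle (le_card_of_binomials ha hbin hspan), ⟨hbin, hspan⟩, ?_⟩
  rintro N ⟨hN, hNspan⟩ hNC
  lift N to Finset (MvPolynomial (Fin n) K) using C.finite_toSet.subset hNC
  have := le_card_of_binomials ha (fun f hf => hN f hf) hNspan
  exact (Finset.eq_of_subset_of_card_le (Finset.coe_subset.1 hNC) (hle.trans this)).ge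

/-! ### Betti degrees -/

/-- Every Betti degree occurs among the weights of any given generating set of moves: otherwise
a Markov element of that degree would be generated by Markov elements of smaller degree. -/
theorem exists_weight_eq_of_mem_bettiDegrees {a : Fin n → ℕ}
    {R : Set (ExpPair n)}
    (hR : Ideal.span ((fun r => binom K r.1 r.2) '' R) = toricIdeal K a) {β : ℕ}
    (hβ : β ∈ bettiDegrees K a) : ∃ r ∈ R, Finsupp.weight a r.1 = β := by
  obtain ⟨M, ⟨⟨hM, hMspan⟩, hmin⟩, u, v, huvM, rfl⟩ := hβ
  by_contra! hno
  have hRcon := span_eq_toricIdeal_iff.1 hR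
  have hRw : ∀ r ∈ R, Finsupp.weight a r.1 = Finsupp.weight a r.2 := fun r hr =>
    (hRcon _ _).1 (moves_of_mem hr)
  let Q : Set (ExpPair n) := {r | binom K r.1 r.2 ∈ M}
  have hQM : (fun r => binom K r.1 r.2) '' Q = M := by
    refine Set.Subset.antisymm (by rintro _ ⟨r, hr, rfl⟩; exact hr) fun f hf => ?_
    obtain ⟨p, q, rfl⟩ := hM f hf
    exact ⟨(p, q), hf, rfl⟩
  have hQcon := span_eq_toricIdeal_iff.1 (hQM.symm ▸ hMspan)
  have hQw : ∀ r ∈ Q, Finsupp.weight a r.1 = Finsupp.weight a r.2 := fun r hr =>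
    (hQcon _ _).1 (moves_of_mem hr)
  have huv : Finsupp.weight a u = Finsupp.weight a v := hQw (u, v) huvM
  have hred : binom K u v ∈ Ideal.span (M \ {binom K u v}) := by
    by_cases hne : u = v
    · simp [binom, hne]
    refine idealCon_apply.1 (moves_le.2 ?_ (moves_weight_le hRw ((hRcon u v).2 huv)))
    rintro p q ⟨hpR, hpw⟩
    have hlt : Finsupp.weight a p < Finsupp.weight a u := lt_of_le_of_ne hpw (hno _ hpR)
    refine moves_le.2 ?_ (moves_weight_le hQw ((hQcon p q).2 (hRw _ hpR)))
    rintro p' q' ⟨hpQ, hpw'⟩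
    refine idealCon_apply.2 (Ideal.subset_span ⟨hpQ, fun heq => ?_⟩)
    have := weight_eq_of_binom_eq hne (hQw _ hpQ) (Set.mem_singleton_iff.1 heq).symm
    exact absurd (this.trans_le hpw') (not_le.2 hlt)
  have hsub : M ⊆ M \ {binom K u v} := by
    refine hmin ⟨fun f hf => hM f hf.1, ?_⟩ Set.sdiff_subset
    refine le_antisymm (hMspan ▸ Ideal.span_mono Set.sdiff_subset) (hMspan ▸ Ideal.span_le.2 ?_)
    intro f hf
    by_cases hfe : f = binom K u v
    · exact hfe ▸ hred
    · exact Ideal.subset_span ⟨hf, hfe⟩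
  exact (hsub huvM).2 rfl

theorem bettiDegrees_eq {a : Fin n → ℕ} (hn : 0 < n) (ha : ∀ i, 0 < a i)
    (hfree : IsSubsetFree a) :
    bettiDegrees K a = {m | ∃ i j, i ≠ j ∧ m = Nat.lcm (a i) (a j)} := by
  ext β
  constructor
  · intro hβ
    obtain ⟨R, -, hR⟩ := (IsGluing.singleton (a := a) ⟨0, hn⟩).extend ha hfree Finset.univ
    rw [Finset.union_eq_left.2 (Finset.subset_univ _)] at hR
    obtain ⟨r, hr, rfl⟩ := exists_weight_eq_of_mem_bettiDegrees (hR.span_eq ha) hβ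
    obtain ⟨k, j, hkj, rfl⟩ := hR.exists_of_mem r hr
    exact ⟨k, j, hkj, weight_circuitPair_fst a k j⟩
  · rintro ⟨i, j, hij, rfl⟩
    have h₀ : IsGluing a {i, j} {circuitPair a i j} :=
      (IsGluing.singleton j).adjoin (by simpa using hij) (Finset.mem_singleton_self j)
        (by simpa using Nat.dvd_lcm_right _ _)
    obtain ⟨R, hsub, hR⟩ := h₀.extend ha hfree Finset.univ
    rw [Finset.union_eq_left.2 (Finset.subset_univ _)] at hR
    obtain ⟨C, hC, -, hM⟩ := hR.exists_isMarkovBasis (K := K) ha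
    refine ⟨C, hM, (circuitPair a i j).1, (circuitPair a i j).2, ?_, weight_circuitPair_fst a i j⟩
    rw [hC]
    exact ⟨circuitPair a i j, hsub (Finset.mem_singleton_self _), rfl⟩

end NumSemigroup

theorem proposition3p5 (K : Type*) [Field K] (n : ℕ) (a : Fin n → ℕ)
    (ha : NumSemigroup.IsMinimalGeneratingSet a) (hfree : NumSemigroup.IsUniversallyFree a) :
    (2 ≤ n → ∀ i, NumSemigroup.criticalExponent a i = (Finset.univ.erase i).gcd a) ∧
    (∀ β ∈ NumSemigroup.bettiDegrees K a, ∃ k, NumSemigroup.criticalExponent a k * a k ∣ β) ∧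
    (∃ C : Finset (MvPolynomial (Fin n) K), C.card = n - 1 ∧
      (∀ f ∈ C, NumSemigroup.IsCircuit K a f) ∧
      NumSemigroup.IsMarkovBasis K a (C : Set (MvPolynomial (Fin n) K))) ∧
    NumSemigroup.bettiDegrees K a = {m | ∃ i j, i ≠ j ∧ m = Nat.lcm (a i) (a j)} := by
  have hsub := hfree.isSubsetFree
  have hn : 0 < n := by
    rcases Nat.eq_zero_or_pos n with rfl | hn
    · simpa using ha.gcd_eq_one
    · exact hn
  have hbetti := NumSemigroup.bettiDegrees_eq (K := K) hn ha.pos hsub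
  refine ⟨fun h2 i => NumSemigroup.criticalExponent_eq_gcd h2 ha.pos ha.gcd_eq_one hsub i,
    ?_, ?_, hbetti⟩
  · intro β hβ
    rw [hbetti] at hβ
    obtain ⟨i, j, hij, rfl⟩ := hβ
    have h2 : 2 ≤ n := Fin.nontrivial_iff_two_le.1 ⟨i, j, hij⟩
    refine ⟨i, ?_⟩
    rw [NumSemigroup.criticalExponent_eq_gcd h2 ha.pos ha.gcd_eq_one hsub i]
    exact NumSemigroup.gcd_erase_mul_dvd_lcm ha.gcd_eq_one hij
  · obtain ⟨R, -, hR⟩ :=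
      (NumSemigroup.IsGluing.singleton (a := a) ⟨0, hn⟩).extend ha.pos hsub Finset.univ
    rw [Finset.union_eq_left.2 (Finset.subset_univ _)] at hR
    obtain ⟨C, hC, hcard, hM⟩ := hR.exists_isMarkovBasis (K := K) ha.pos
    refine ⟨C, hcard, fun f hf => ?_, hM⟩
    have hf' : f ∈ (C : Set (MvPolynomial (Fin n) K)) := hf
    rw [hC] at hf'
    obtain ⟨r, hr, rfl⟩ := hf'
    obtain ⟨k, j, hkj, rfl⟩ := hR.exists_of_mem r hr
    exact NumSemigroup.isCircuit_circuitPair ha.pos hkj
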